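/- Let $n$ agents have locations $x=(x_1,\dots,x_n)\in\mathbb R^n$. If facilities stand at $l_1,l_2\in\mathbb R$, an agent at $y$ has cost $\min(|l_1-y|,|l_2-y|)$; the social cost is the sum of the agents' costs, and $\mathrm{OPT}(x)$ is the infimum of the social cost of $x$ over all $(l_1,l_2)\in\mathbb R^2$. A deterministic mechanism with predictions is a function $f$ that maps a predicted profile $\tilde x\in\mathbb R^n$ and a reported profile $x\in\mathbb R^n$ to two facility locations $f(\tilde x,x)\in\mathbb R^2$. It is strategy-proof if, for every fixed prediction $\tilde x$, every profile $x$, every agent $i$ and every $y\in\mathbb R$, agent $i$ located at $x_i$ does not lower her cost by reporting $y$ instead of $x_i$. Write $\mathrm{SC}(f,\tilde x,x)$ for the social cost of $f(\tilde x,x)$ on $x$. The mechanism is $\rho$-robust if $\mathrm{SC}(f,\tilde x,x)\le\rho\,\mathrm{OPT}(x)$ for all $\tilde x,x$; it has bounded robustness if it is $\rho$-robust for some real $\rho$; and it is $\gamma$-consistent if $\mathrm{SC}(f,x,x)\le\gamma\,\mathrm{OPT}(x)$ for all $x$. **Theorem.** Let $n\ge 5$ and let $f$ be a deterministic strategy-proof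 mechanism with predictions for $n$ agents whose robustness is bounded. (a) If $f$ is $\gamma$-consistent, then $\gamma\ge n/4$ if $n$ is even, and $\gamma\ge (n-1)/4$ if $n$ is odd. (b) This bound is forced by explicit profiles: let $0<\varepsilon<1/4$ and let $x$ be any profile with one agent at $0$, one agent at $1$, $\lfloor n/2\rfloor-1$ agents at $\varepsilon$ and the remaining $\lceil n/2\rceil-1$ agents at $1-\varepsilon$. Then $\mathrm{OPT}(x)=2\varepsilon$ and $\mathrm{SC}(f,x,x)\ge\lfloor n/2\rfloor\,\varepsilon$. (c) Consequently the consistency is $\Omega(n)$: if for all sufficiently large $n$ the mechanism $f_n$ for $n$ agents is deterministic and strategy-proof, has bounded robustness (with a bound that may depend on $n$), and is $\gamma_n$-consistent, then $\gamma_n=\Omega(n)$. -/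

import Mathlib

open scoped BigOperators

namespace TwoFacility

/-- A location profile of `n` agents on the real line. -/
abbrev Profile (n : ℕ) : Type := Fin n → ℝ

/-- The cost of an agent located at `y`: the distance to the nearest of the two facilities. -/
noncomputable def cost (l : ℝ × ℝ) (y : ℝ) : ℝ := min (dist l.1 y) (dist l.2 y)

/-- The total cost of all agents when the facilities are at `l.1` and `l.2`. -/
noncomputable def totalCost {n : ℕ} (l : ℝ × ℝ) (x : Profile n) : ℝ := ∑ i, cost l (x i)

/-- The optimal social cost of a location profile. -/
noncomputable def OPT {n : ℕ} (x : Profile n) : ℝ := ⨅ l : ℝ × ℝ, totalCost l x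

/-- A deterministic mechanism: it maps reported profiles to the locations of two facilities. -/
abbrev Mechanism (n : ℕ) : Type := Profile n → ℝ × ℝ

/-- The social cost of the mechanism `f` on the profile `x`. -/
noncomputable def SC {n : ℕ} (f : Mechanism n) (x : Profile n) : ℝ := totalCost (f x) x

/-- No agent `i` (at her true location `x i`) can benefit from reporting `y` instead, whatever the
reports of the other agents are. -/
def StrategyProof {n : ℕ} (f : Mechanism n) : Prop :=
  ∀ (x : Profile n) (i : Fin n) (y : ℝ),
    cost (f x) (x i) ≤ cost (f (Function.update x i y)) (x i)

/-- The approximation ratio of `f` is at most `γ`. -/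
def HasApproxRatio {n : ℕ} (f : Mechanism n) (γ : ℝ) : Prop :=
  ∀ x : Profile n, SC f x ≤ γ * OPT x

/-- A deterministic mechanism with prediction: its input is a predicted profile and a reported
profile. -/
abbrev PredMechanism (n : ℕ) : Type := Profile n → Mechanism n

/-- The prediction is public and cannot be manipulated, so strategy-proofness is required for each
prediction separately. -/
def PredStrategyProof {n : ℕ} (f : PredMechanism n) : Prop :=
  ∀ p : Profile n, StrategyProof (f p)

/-- `f` is `γ`-consistent: its approximation ratio is at most `γ` when the prediction is exact. -/
def IsConsistent {n : ℕ} (f : PredMechanism n) (γ : ℝ) : Prop :=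
  ∀ x : Profile n, SC (f x) x ≤ γ * OPT x

/-- `f` is `ρ`-robust: its approximation ratio is at most `ρ` for every prediction. -/
def IsRobust {n : ℕ} (f : PredMechanism n) (ρ : ℝ) : Prop :=
  ∀ p : Profile n, HasApproxRatio (f p) ρ

/-- One agent at `0`, one at `1`, `⌊n/2⌋ - 1` agents at `ε` and all remaining agents
(`⌈n/2⌉ - 1` of them) at `1 - ε`; which agent is where is arbitrary. -/
def IsClusterProfile {n : ℕ} (ε : ℝ) (x : Profile n) : Prop :=
  {i | x i = 0}.ncard = 1 ∧ {i | x i = 1}.ncard = 1 ∧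
    {i | x i = ε}.ncard = n / 2 - 1 ∧ {i | x i = 1 - ε}.ncard = n - n / 2 - 1

end TwoFacility

/-! Fixing the prediction to be the cluster profile itself leaves an ordinary strategy-proof
mechanism with bounded approximation ratio. If its cost there is below `⌊n/2⌋ * ε`, its facilities
serve the agents at `0` and `1` strictly from the inside (`exists_serves_of_cost_lt`). Co-located
agents cannot gain jointly, so the four groups act as four agents, and `FourAgent.not_serves_inside`
excludes this configuration.

The core is a duel. Two agents close together, with a third far away, must share one facility, since
the other has to stay with the third. With three agents, whether the second beats the first in this
duel depends on no location (`ThreeAgent.wins_of_wins'`): victory passes from one side to the other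
by reflection, and two agents cannot both beat each other. So the second agent is either served
whenever in the middle (`serves_middle`), or the leftmost agent is always served (`serves_left`).

With four agents, pairs are merged to obtain three. Service from the inside lets the pairs 2,3 and
2,4, and by reflection 1,3, win their duels. This forces agent 3 to be served between the pair 1,2
and agent 4 (`serves_middle₁₂`), and symmetrically for agent 2. Then both inner agents are served in
every ordered profile (`serves_second`), which leaves no facility for a distant fourth agent. -/

namespace TwoFacility

/-! ### Costs and pairs of facilities. -/

/-- One of the two facilities stands at `t`. -/
def Serves (l : ℝ × ℝ) (t : ℝ) : Prop := l.1 = t ∨ l.2 = t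

theorem cost_nonneg (l : ℝ × ℝ) (t : ℝ) : 0 ≤ cost l t := le_min dist_nonneg dist_nonneg

theorem Serves.cost_le {l : ℝ × ℝ} {q : ℝ} (h : Serves l q) (t : ℝ) : cost l t ≤ |q - t| := by
  rcases h with h | h
  · rw [← h]; exact (min_le_left _ _).trans_eq (Real.dist_eq _ _)
  · rw [← h]; exact (min_le_right _ _).trans_eq (Real.dist_eq _ _)

theorem exists_serves (l : ℝ × ℝ) (t : ℝ) : ∃ q, Serves l q ∧ |q - t| = cost l t := by
  rcases min_choice (dist l.1 t) (dist l.2 t) with h | h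
  · exact ⟨l.1, Or.inl rfl, by rw [cost, h, Real.dist_eq]⟩
  · exact ⟨l.2, Or.inr rfl, by rw [cost, h, Real.dist_eq]⟩

theorem exists_serves_of_cost_le {l : ℝ × ℝ} {t c : ℝ} (h : cost l t ≤ c) :
    ∃ q, Serves l q ∧ t - c ≤ q ∧ q ≤ t + c := by
  obtain ⟨q, hq, hd⟩ := exists_serves l t
  have := abs_le.1 (hd.le.trans h)
  exact ⟨q, hq, by linarith, by linarith⟩

theorem serves_of_cost_nonpos {l : ℝ × ℝ} {t : ℝ} (h : cost l t ≤ 0) : Serves l t := by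
  obtain ⟨q, hq, h1, h2⟩ := exists_serves_of_cost_le h
  have : q = t := by linarith
  exact this ▸ hq

theorem Serves.cost_eq_zero {l : ℝ × ℝ} {t : ℝ} (h : Serves l t) : cost l t = 0 :=
  le_antisymm (by simpa using h.cost_le t) (cost_nonneg _ _)

theorem cost_le_add (l : ℝ × ℝ) (s t : ℝ) : cost l s ≤ cost l t + |s - t| := by
  obtain ⟨q, hq, hd⟩ := exists_serves l t
  rw [← hd]
  calc cost l s ≤ |q - s| := hq.cost_le s
    _ = |(q - t) - (s - t)| := by ring_nf
    _ ≤ _ := abs_sub _ _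

/-- A pair of locations holds at most two points. -/
theorem Serves.eq_or_eq {l : ℝ × ℝ} {a b c : ℝ} (ha : Serves l a) (hb : Serves l b) (hab : a ≠ b)
    (hc : Serves l c) : c = a ∨ c = b := by
  unfold Serves at *
  rcases ha with ha | ha <;> rcases hb with hb | hb <;> rcases hc with hc | hc <;> subst_vars <;>
    simp_all

/-- Reflection of a pair of locations. -/
def refl (l : ℝ × ℝ) : ℝ × ℝ := (-l.1, -l.2)

theorem serves_refl {l : ℝ × ℝ} {t : ℝ} : Serves (refl l) t ↔ Serves l (-t) := by
  simp [Serves, refl, neg_eq_iff_eq_neg]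

theorem cost_refl (l : ℝ × ℝ) (t : ℝ) : cost (refl l) t = cost l (-t) := by
  have h : ∀ a : ℝ, dist (-a) t = dist a (-t) := fun a => by
    rw [Real.dist_eq, Real.dist_eq, ← abs_neg]; ring_nf
  simp [cost, refl, h]

theorem refl_refl (l : ℝ × ℝ) : refl (refl l) = l := by simp [refl]

/-! ### Outcomes as the report of a single agent varies. -/

/-- Truthful reporting is optimal for an agent whose report `t` leads to the outcome `φ t`. -/
def Truthful (φ : ℝ → ℝ × ℝ) : Prop := ∀ s t, cost (φ s) s ≤ cost (φ t) s

namespace Truthful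

variable {φ : ℝ → ℝ × ℝ}

/-- An agent at `q` could report `t` at cost zero. Hence every location reachable by some report is
reached by reporting that location; this lets an agent move onto a facility without destroying it.
-/
theorem serves (h : Truthful φ) {t q : ℝ} (hq : Serves (φ t) q) : Serves (φ q) q :=
  serves_of_cost_nonpos ((h q t).trans_eq hq.cost_eq_zero)

theorem cost_le_add (h : Truthful φ) (s t : ℝ) : cost (φ s) s ≤ cost (φ t) t + |s - t| :=
  (h s t).trans (TwoFacility.cost_le_add _ _ _)

theorem reflect (h : Truthful φ) : Truthful fun t => refl (φ (-t)) := fun s t => by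
  simpa only [cost_refl] using h (-s) (-t)

/-- The left end `p` of a gap in the range of outcomes is chosen by all reports just above it. -/
theorem exists_left_end (h : Truthful φ) {s t : ℝ} (hst : s < t) (hs : Serves (φ s) s)
    (ht : ¬ Serves (φ t) t) :
    ∃ p, s ≤ p ∧ p < t ∧ ∀ η, 0 < η → 2 * η ≤ t - p → Serves (φ (p + η)) p := by
  set I : Set ℝ := {q | q ≤ t ∧ Serves (φ q) q}
  have hne : I.Nonempty := ⟨s, hst.le, hs⟩
  have hbd : BddAbove I := ⟨t, fun q hq => hq.1⟩
  have hpt : sSup I ≤ t := csSup_le hne fun q hq => hq.1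
  have hp : Serves (φ (sSup I)) (sSup I) := by
    refine serves_of_cost_nonpos (le_of_forall_pos_le_add fun e he => ?_)
    obtain ⟨q, hq, hqe⟩ := exists_lt_of_lt_csSup hne (sub_lt_self (sSup I) he)
    have h1 := h.cost_le_add (sSup I) q
    rw [hq.2.cost_eq_zero, abs_of_nonneg (sub_nonneg.2 (le_csSup hbd hq))] at h1
    linarith
  refine ⟨sSup I, le_csSup hbd ⟨hst.le, hs⟩, lt_of_le_of_ne hpt fun e => ht (e ▸ hp),
    fun η h0 hη => ?_⟩
  have h1 : cost (φ (sSup I + η)) (sSup I + η) ≤ η := by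
    refine (h _ (sSup I)).trans ((hp.cost_le _).trans ?_)
    rw [abs_le]; constructor <;> linarith
  obtain ⟨q, hq, hq1, hq2⟩ := exists_serves_of_cost_le h1
  -- The bound `2 * η ≤ t - p` ensures `q ≤ t`, so `q` belongs to `I`.
  have h2 : q ≤ sSup I := le_csSup hbd ⟨by linarith, h.serves hq⟩
  have : q = sSup I := by linarith
  exact this ▸ hq

theorem exists_right_end (h : Truthful φ) {s t : ℝ} (hst : t < s) (hs : Serves (φ s) s)
    (ht : ¬ Serves (φ t) t) :
    ∃ p, p ≤ s ∧ t < p ∧ ∀ η, 0 < η → 2 * η ≤ p - t → Serves (φ (p - η)) p := by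
  obtain ⟨p, h1, h2, h3⟩ := h.reflect.exists_left_end (s := -s) (t := -t) (by linarith)
    (by simpa [serves_refl] using hs) (by simpa [serves_refl] using ht)
  refine ⟨-p, by linarith, by linarith, fun η h0 hη => ?_⟩
  have := h3 η h0 (by linarith)
  rw [serves_refl] at this
  convert this using 2
  ring

/-- If `u` is the nearest outcome to the right of an agent at `s`, it remains an outcome for all
reports between `s` and `u`. -/
theorem serves_of_between (h : Truthful φ) {s t u : ℝ} (hu : Serves (φ s) u)
    (hc : cost (φ s) s = u - s) (hst : s < t) (htu : t ≤ u) : Serves (φ t) u := by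
  have h1 : cost (φ t) t ≤ u - t :=
    (h t s).trans ((hu.cost_le t).trans_eq (abs_of_nonneg (by linarith)))
  obtain ⟨q, hq, hq1, hq2⟩ := exists_serves_of_cost_le h1
  have h2 : u - s ≤ |q - s| := hc ▸ (h s t).trans (hq.cost_le s)
  have : u ≤ q := by
    rcases le_abs.1 h2 with h3 | h3 <;> linarith
  have : q = u := by linarith
  exact this ▸ hq

end Truthful

/-! ### The duel of two close agents. -/

/-- Two agents to the left of `Z` whose reports `x`, `y` lead to the outcome `Φ x y`. If they are
close to each other, then one of the facilities is too far away to serve them. -/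
structure Contest (Φ : ℝ → ℝ → ℝ × ℝ) (Z M : ℝ) : Prop where
  truthful_left : ∀ y, Truthful fun x => Φ x y
  truthful_right : ∀ x, Truthful (Φ x)
  diag : ∀ x, x < Z → Serves (Φ x x) x
  far : ∀ x y, x < y → M * (y - x) < Z - y → ∃ w, Serves (Φ x y) w ∧ 2 * y - x < w
  nonneg : 0 ≤ M

/-- The left agent at `x` is not served although the right agent is close to her. -/
def Loses (Φ : ℝ → ℝ → ℝ × ℝ) (Z M x : ℝ) : Prop :=
  ∃ y, x < y ∧ M * (y - x) < Z - y ∧ ¬ Serves (Φ x y) x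

namespace Contest

variable {Φ : ℝ → ℝ → ℝ × ℝ} {Z M : ℝ}

theorem lt_of_near (h : Contest Φ Z M) {x y : ℝ} (hxy : x < y) (hn : M * (y - x) < Z - y) :
    y < Z := by
  nlinarith [mul_nonneg h.nonneg (sub_nonneg.2 hxy.le)]

theorem near_mono (h : Contest Φ Z M) {x y x' y' : ℝ} (hn : M * (y - x) < Z - y) (hx : x ≤ x')
    (hy : y' ≤ y) : M * (y' - x') < Z - y' := by
  nlinarith [mul_le_mul_of_nonneg_left (show y' - x' ≤ y - x by linarith) h.nonneg]

theorem exists_near (h : Contest Φ Z M) {x : ℝ} (hx : x < Z) :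
    ∃ d, 0 < d ∧ x + d < Z ∧ ∀ e, 0 ≤ e → e ≤ d → M * e < Z - (x + e) := by
  have hM := h.nonneg
  refine ⟨(Z - x) / (M + 2), by apply div_pos <;> linarith, ?_, fun e h0 he => ?_⟩
  · have : (Z - x) / (M + 2) < Z - x := by
      rw [div_lt_iff₀ (by linarith)]; nlinarith
    linarith
  · have : e * (M + 2) ≤ Z - x := (le_div_iff₀ (by linarith)).1 he
    rcases h0.eq_or_lt with rfl | h0
    · linarith
    · nlinarith

/-- Close agents share a facility between them, and the other facility is far away. -/
theorem near_facility (h : Contest Φ Z M) {x y : ℝ} (hxy : x < y) (hn : M * (y - x) < Z - y) :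
    ∃ u, x ≤ u ∧ u ≤ y ∧ Serves (Φ x y) u ∧ (∀ q, Serves (Φ x y) q → q = u ∨ 2 * y - x < q) ∧
      ∀ t, x ≤ t → t ≤ y → cost (Φ x y) t = |u - t| := by
  have hyZ := h.lt_of_near hxy hn
  obtain ⟨w, hw, hwy⟩ := h.far x y hxy hn
  have h1 : cost (Φ x y) x ≤ y - x := by
    refine (h.truthful_left y x y).trans (((h.diag y hyZ).cost_le x).trans_eq ?_)
    exact abs_of_pos (by linarith)
  have h2 : cost (Φ x y) y ≤ y - x := by
    refine (h.truthful_right x y x).trans (((h.diag x (by linarith)).cost_le y).trans_eq ?_)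
    rw [abs_sub_comm]; exact abs_of_pos (by linarith)
  obtain ⟨u, hu, hu1, hu2⟩ := exists_serves_of_cost_le h1
  obtain ⟨u', hu', hu1', hu2'⟩ := exists_serves_of_cost_le h2
  -- Both `u` and `u'` are at most `2 * y - x`, hence different from `w`; a pair of facilities has
  -- no room for three points.
  have huw : u ≠ w := by intro e; linarith
  have huu : u' = u := by
    rcases hu.eq_or_eq hw huw hu' with e | e
    · exact e
    · linarith
  subst huu
  have hq : ∀ q, Serves (Φ x y) q → q = u' ∨ 2 * y - x < q := fun q hq =>
    (hu.eq_or_eq hw huw hq).imp_right fun e => hwy.trans_eq e.symm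
  refine ⟨u', by linarith, by linarith, hu, hq, fun t ht1 ht2 => le_antisymm (hu.cost_le t) ?_⟩
  obtain ⟨q, hq', hqt⟩ := exists_serves (Φ x y) t
  rw [← hqt]
  rcases hq q hq' with rfl | h3
  · exact le_rfl
  · rw [abs_of_pos (show 0 < q - t by linarith), abs_le]
    constructor <;> linarith

theorem serves_unique (h : Contest Φ Z M) {x y u q : ℝ} (hxy : x < y)
    (hn : M * (y - x) < Z - y) (hu : Serves (Φ x y) u) (hq : Serves (Φ x y) q) (huy : u ≤ y)
    (hqy : q ≤ y) : q = u := by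
  obtain ⟨v, -, -, -, hv, -⟩ := h.near_facility hxy hn
  have h1 := (hv u hu).resolve_right (by linarith)
  have h2 := (hv q hq).resolve_right (by linarith)
  rw [h1, h2]

theorem loses_of_serves (h : Contest Φ Z M) {x y u : ℝ} (hxy : x < y)
    (hn : M * (y - x) < Z - y) (hu : Serves (Φ x y) u) (hxu : x < u) (huy : u ≤ y) :
    Loses Φ Z M x :=
  ⟨y, hxy, hn, fun hx => hxu.ne (h.serves_unique hxy hn hu hx huy hxy.le)⟩

/-- A losing agent loses against all agents that are close enough. -/
theorem serves_of_loses (h : Contest Φ Z M) {x : ℝ} (hx : Loses Φ Z M x) :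
    ∃ u, x < u ∧ M * (u - x) < Z - u ∧ ∀ y, x < y → y ≤ u → Serves (Φ x y) y := by
  obtain ⟨y, hxy, hn, hns⟩ := hx
  obtain ⟨u, hxu, huy, hu, -, -⟩ := h.near_facility hxy hn
  have hxu : x < u := lt_of_le_of_ne hxu fun e => hns (e ▸ hu)
  refine ⟨u, hxu, h.near_mono hn le_rfl huy, fun t hxt htu => ?_⟩
  by_contra ht
  have hu' : Serves (Φ x u) u := (h.truthful_right x).serves hu
  have htu : t < u := lt_of_le_of_ne htu fun e => ht (by rw [e]; exact hu')
  obtain ⟨q, hqu, htq, hq⟩ := (h.truthful_right x).exists_right_end htu hu' ht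
  -- With the right agent at `q - η`, the facility `q` lies beyond her, but `3 * η ≤ q - x` keeps it
  -- within `2 * (q - η) - x`, where only the common facility is allowed.
  have h0 : 0 < min ((q - t) / 2) ((q - x) / 3) := lt_min (by linarith) (by linarith)
  have h1 := min_le_left ((q - t) / 2) ((q - x) / 3)
  have h2 := min_le_right ((q - t) / 2) ((q - x) / 3)
  set η := min ((q - t) / 2) ((q - x) / 3)
  obtain ⟨v, hv1, hv2, -, hv, -⟩ := h.near_facility (x := x) (y := q - η) (by linarith)
    (h.near_mono hn le_rfl (by linarith))
  rcases hv q (hq η h0 (by linarith)) with h3 | h3 <;> linarith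

/-- The common facility of two close agents is not a losing position unless it serves the right
agent. -/
theorem not_loses_of_serves (h : Contest Φ Z M) {x y u : ℝ}
    (hn : M * (y - x) < Z - y) (hu : Serves (Φ x y) u) (hxu : x ≤ u) (huy : u < y) :
    ¬ Loses Φ Z M u := by
  intro hl
  have hu' : Serves (Φ u y) u := (h.truthful_left y).serves hu
  have hn' : M * (y - u) < Z - y := h.near_mono hn hxu le_rfl
  obtain ⟨v, hv1, hv2, hv, -, hvc⟩ := h.near_facility huy hn'
  have hvu : v = u := h.serves_unique huy hn' hu' hv huy.le hv2
  subst hvu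
  obtain ⟨t, hut, -, ht⟩ := h.serves_of_loses hl
  -- If `v` were losing, the right agent at `y` could report `y'` and draw the facility from `v` to
  -- `y'`, closer to her.
  set y' := min t ((v + y) / 2)
  have h1 : v < y' := lt_min hut (by linarith)
  have h2 : y' ≤ (v + y) / 2 := min_le_right _ _
  have h3 := ((h.truthful_right v) y y').trans ((ht y' h1 (min_le_left _ _)).cost_le y)
  rw [hvc y huy.le le_rfl, abs_of_neg (by linarith), abs_of_neg (by linarith)] at h3
  linarith

/-- If all positions from `x` on are losing, then the right agent is served. -/
theorem serves_right (h : Contest Φ Z M) {x y : ℝ} (hxy : x < y) (hn : M * (y - x) < Z - y)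
    (hl : ∀ t, x ≤ t → t < y → Loses Φ Z M t) : Serves (Φ x y) y := by
  obtain ⟨u, hxu, huy, hu, -, -⟩ := h.near_facility hxy hn
  rcases huy.eq_or_lt with e | huy
  · exact e ▸ hu
  · exact absurd (hl u hxu huy) (h.not_loses_of_serves hn hu hxu huy)

/-- The losing positions form a down-closed set. -/
theorem loses_of_le (h : Contest Φ Z M) {x y : ℝ} (hyx : y ≤ x) (hx : Loses Φ Z M x) :
    Loses Φ Z M y := by
  by_contra hy
  set N : Set ℝ := {s | s ≤ x ∧ ¬ Loses Φ Z M s}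
  have hne : N.Nonempty := ⟨y, hyx, hy⟩
  have hbd : BddAbove N := ⟨x, fun s hs => hs.1⟩
  have hgx : sSup N ≤ x := csSup_le hne fun s hs => hs.1
  by_cases hg : Loses Φ Z M (sSup N)
  -- The supremum loses: against `u` the agent at `sSup N` pays `u - g`, but reporting a non-losing
  -- `s` just to the left brings a facility to `s`, which is nearer.
  · obtain ⟨u, hgu, hn, hu⟩ := h.serves_of_loses hg
    obtain ⟨v, hv1, hv2, hv, -, hvc⟩ := h.near_facility hgu hn
    have hvu : v = u := h.serves_unique hgu hn (hu u hgu le_rfl) hv le_rfl hv2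
    have hc := hvc _ le_rfl hgu.le
    rw [hvu, abs_of_pos (sub_pos.2 hgu)] at hc
    set g := sSup N
    obtain ⟨d, hd, hd'⟩ : ∃ d, 0 < d ∧ M * (u - (g - d)) < Z - u := by
      have hM := h.nonneg
      refine ⟨(Z - u - M * (u - g)) / (M + 1), by apply div_pos <;> linarith, ?_⟩
      have : M * ((Z - u - M * (u - g)) / (M + 1)) < Z - u - M * (u - g) := by
        rw [mul_div_assoc', div_lt_iff₀ (by linarith)]; nlinarith
      linarith
    obtain ⟨s, hs, hsg⟩ := exists_lt_of_lt_csSup hne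
      (show g - min d ((u - g) / 2) < g from sub_lt_self _ (lt_min hd (by linarith)))
    have h1 := min_le_left d ((u - g) / 2)
    have h2 := min_le_right d ((u - g) / 2)
    have hsg' : s ≤ g := le_csSup hbd hs
    have hss : Serves (Φ s u) s := by
      by_contra hss
      exact hs.2 ⟨u, by linarith, h.near_mono hd' (by linarith) le_rfl, hss⟩
    have h3 := (h.truthful_left u).cost_le_add g s
    rw [hc, hss.cost_eq_zero, abs_of_nonneg (by linarith)] at h3
    linarith
  -- The supremum does not lose: against `g + e`, the agent at `g + e / 4` loses and pays `3 * e /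
  -- 4`, whereas reporting `g` costs `e / 4`.
  · set g := sSup N
    have hgx : g < x := lt_of_le_of_ne hgx fun e => hg (e ▸ hx)
    have hxZ : x < Z := by
      obtain ⟨t, ht, hn, -⟩ := hx
      exact ht.trans (h.lt_of_near ht hn)
    obtain ⟨d, hd, hdZ, hdn⟩ := h.exists_near (hgx.trans hxZ)
    have h0 : 0 < min d (x - g) := lt_min hd (by linarith)
    have h1 := min_le_left d (x - g)
    have h2 := min_le_right d (x - g)
    set e := min d (x - g)
    have hn : M * (g + e - g) < Z - (g + e) := by simpa using hdn e h0.le h1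
    have hgs : Serves (Φ g (g + e)) g := by
      by_contra hgs
      exact hg ⟨g + e, by linarith, hn, hgs⟩
    have hn' : M * (g + e - (g + e / 4)) < Z - (g + e) := h.near_mono hn (by linarith) le_rfl
    have hs := h.serves_right (x := g + e / 4) (by linarith) hn' fun t ht1 ht2 => by
      by_contra hc
      have := le_csSup hbd (show t ∈ N from ⟨by linarith, hc⟩)
      linarith
    obtain ⟨v, hv1, hv2, hv, -, hvc⟩ := h.near_facility (by linarith) hn'
    have hvu : v = g + e := h.serves_unique (by linarith) hn' hs hv le_rfl hv2
    have h3 := (h.truthful_left (g + e)).cost_le_add (g + e / 4) g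
    rw [hgs.cost_eq_zero, hvc _ le_rfl (by linarith), hvu, abs_of_pos (by linarith),
      abs_of_pos (by linarith)] at h3
    linarith

/-- If all positions to the left of `Z'` are losing, then the winner gets a facility to the left
of `Z'` wherever the loser is. -/
theorem serves_of_forall_loses (h : Contest Φ Z M) {Z' x y : ℝ} (hZ : Z' ≤ Z)
    (hl : ∀ t, t < Z' → Loses Φ Z M t) (hb : ∃ s, s < y ∧ Serves (Φ x s) s) (hy : y < Z') :
    Serves (Φ x y) y := by
  by_contra hns
  obtain ⟨s, hsy, hs⟩ := hb
  obtain ⟨p, -, hpy, hp⟩ := (h.truthful_right x).exists_left_end hsy hs hns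
  obtain ⟨d, hd, -, hdn⟩ := h.exists_near (show p < Z by linarith)
  have h0 : 0 < min d ((y - p) / 2) := lt_min hd (by linarith)
  have h1 := min_le_left d ((y - p) / 2)
  have h2 := min_le_right d ((y - p) / 2)
  set e := min d ((y - p) / 2)
  have hn : M * (p + e - p) < Z - (p + e) := by simpa using hdn e h0.le h1
  have h3 := h.serves_right (by linarith) hn fun t _ ht => hl t (by linarith)
  -- The left agent moves onto the edge `p` of the gap and keeps her facility, although she should
  -- lose there.
  have h4 : Serves (Φ p (p + e)) p := (h.truthful_left (p + e)).serves (hp e h0 (by linarith))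
  have := h.serves_unique (by linarith) hn h3 h4 le_rfl (by linarith)
  linarith

end Contest

/-! ### Three agents: the winner of the duel does not depend on the locations. -/

/-- A strategy-proof mechanism for three agents with approximation ratio at most `K`. -/
structure ThreeAgent (F : ℝ → ℝ → ℝ → ℝ × ℝ) (K : ℝ) : Prop where
  truthful₁ : ∀ y z, Truthful fun x => F x y z
  truthful₂ : ∀ x z, Truthful fun y => F x y z
  truthful₃ : ∀ x y, Truthful fun z => F x y z
  bounded : ∀ x y z l t, t = x ∨ t = y ∨ t = z →
    cost (F x y z) t ≤ K * (cost l x + cost l y + cost l z)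
  nonneg : 0 ≤ K

/-- The mechanism `F` seen in a mirror. -/
def mirror (F : ℝ → ℝ → ℝ → ℝ × ℝ) (x y z : ℝ) : ℝ × ℝ := refl (F (-z) (-y) (-x))

/-- With the third agent at `z`, the first agent at `x` loses against the second one when the
latter is slightly to the right of `x`. -/
def Wins (F : ℝ → ℝ → ℝ → ℝ × ℝ) (K z x : ℝ) : Prop :=
  Loses (fun s t => F s t z) z (K + 1) x

theorem mirror_mirror (F : ℝ → ℝ → ℝ → ℝ × ℝ) : mirror (mirror F) = F := by
  funext x y z; simp [mirror, refl_refl]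

namespace ThreeAgent

variable {F : ℝ → ℝ → ℝ → ℝ × ℝ} {K : ℝ}

theorem mirror (h : ThreeAgent F K) : ThreeAgent (mirror F) K where
  truthful₁ _ _ := (h.truthful₃ _ _).reflect
  truthful₂ _ _ := (h.truthful₂ _ _).reflect
  truthful₃ _ _ := (h.truthful₁ _ _).reflect
  bounded x y z l t ht := by
    have := h.bounded (-z) (-y) (-x) (refl l) (-t) (by
      rcases ht with rfl | rfl | rfl <;> simp)
    simp only [cost_refl, neg_neg] at this
    rw [TwoFacility.mirror, cost_refl]
    linarith
  nonneg := h.nonneg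

theorem swap₁₂ (h : ThreeAgent F K) : ThreeAgent (fun x y z => F y x z) K where
  truthful₁ _ _ := h.truthful₂ _ _
  truthful₂ _ _ := h.truthful₁ _ _
  truthful₃ _ _ := h.truthful₃ _ _
  bounded x y z l t ht := by
    have := h.bounded y x z l t (by tauto)
    linarith
  nonneg := h.nonneg

theorem swap₂₃ (h : ThreeAgent F K) : ThreeAgent (fun x y z => F x z y) K where
  truthful₁ _ _ := h.truthful₁ _ _
  truthful₂ _ _ := h.truthful₃ _ _
  truthful₃ _ _ := h.truthful₂ _ _
  bounded x y z l t ht := by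
    have := h.bounded x z y l t (by tauto)
    linarith
  nonneg := h.nonneg

/-- Facilities at `x` and `z` cost at most `y - x`, so the mechanism has a facility at `z - K * (y -
x)` or beyond. The extra `1` in `K + 1` pushes this past `2 * y - x` instead of merely past `y`. -/
theorem contest (h : ThreeAgent F K) (z : ℝ) : Contest (fun s t => F s t z) z (K + 1) where
  truthful_left y := h.truthful₁ y z
  truthful_right x := h.truthful₂ x z
  diag x _ := by
    refine serves_of_cost_nonpos ((h.bounded x x z (x, z) x (by simp)).trans_eq ?_)
    simp [cost]
  far x y hxy hn := by
    have h1 := h.bounded x y z (x, z) z (by simp)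
    have h2 : cost (x, z) x = 0 := Serves.cost_eq_zero (Or.inl rfl)
    have h3 : cost (x, z) z = 0 := Serves.cost_eq_zero (Or.inr rfl)
    have h4 : cost (x, z) y ≤ y - x := by
      refine (Serves.cost_le (Or.inl rfl) y).trans_eq ?_
      rw [abs_sub_comm]; exact abs_of_pos (by simpa using hxy)
    have h5 : cost (F x y z) z ≤ K * (y - x) := by
      refine h1.trans (mul_le_mul_of_nonneg_left ?_ h.nonneg)
      linarith
    obtain ⟨w, hw, hw1, -⟩ := exists_serves_of_cost_le h5
    exact ⟨w, hw, by linarith⟩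
  nonneg := by linarith [h.nonneg]

theorem lt_of_wins (h : ThreeAgent F K) {x z : ℝ} (hw : Wins F K z x) : x < z := by
  obtain ⟨y, hxy, hn, -⟩ := hw
  exact hxy.trans ((h.contest z).lt_of_near hxy hn)

/-- The range of outcomes is unbounded as the report of the second agent varies. -/
theorem exists_serves_lt (h : ThreeAgent F K) (x z t : ℝ) :
    ∃ s, s < t ∧ Serves (F x s z) s := by
  set C := K * |z - x|
  have hC : 0 ≤ C := mul_nonneg h.nonneg (abs_nonneg _)
  have h1 : cost (F x (t - C - 1) z) (t - C - 1) ≤ C := by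
    refine (h.bounded x (t - C - 1) z (t - C - 1, z) _ (by simp)).trans ?_
    refine mul_le_mul_of_nonneg_left ?_ h.nonneg
    have h2 : cost (t - C - 1, z) (t - C - 1) = 0 := Serves.cost_eq_zero (Or.inl rfl)
    have h3 : cost (t - C - 1, z) z = 0 := Serves.cost_eq_zero (Or.inr rfl)
    have h4 : cost (t - C - 1, z) x ≤ |z - x| := Serves.cost_le (Or.inr rfl) x
    linarith
  obtain ⟨q, hq, -, hq2⟩ := exists_serves_of_cost_le h1
  exact ⟨q, by linarith, (h.truthful₂ x z).serves hq⟩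

/-- Two agents cannot both win against each other when they come from the right. -/
theorem not_wins_swap (h : ThreeAgent F K) {z x x' : ℝ} (hx : Wins F K z x)
    (hx' : Wins (fun s t r => F t s r) K z x') : False := by
  have hc := h.contest z
  have hc' := h.swap₁₂.contest z
  set t := min x x' - 1
  have ht : t < x := by linarith [min_le_left x x']
  have ht' : t < x' := by linarith [min_le_right x x']
  obtain ⟨y, -, -, hy⟩ := hc.loses_of_le ht.le hx
  exact hy (hc'.serves_of_forall_loses (h.swap₁₂.lt_of_wins hx').le
    (fun s hs => hc'.loses_of_le hs.le hx') (h.swap₁₂.exists_serves_lt y z t) ht')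

/-- If the second agent wins against the first one at `x₀`, then she is served up to `x₀`. -/
theorem serves_of_wins (h : ThreeAgent F K) {z x₀ x y : ℝ} (hw : Wins F K z x₀) (hxy : x < y)
    (hy : y ≤ x₀) : Serves (F x y z) y := by
  by_contra hns
  have hc := h.contest z
  have hz := h.lt_of_wins hw
  obtain ⟨p, hxp, hpy, hp⟩ := (h.truthful₂ x z).exists_left_end hxy
    (hc.diag x (by linarith)) hns
  obtain ⟨d, hd, -, hdn⟩ := hc.exists_near (show p < z by linarith)
  have h0 : 0 < min d ((y - p) / 2) := lt_min hd (by linarith)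
  have h1 := min_le_left d ((y - p) / 2)
  have h2 := min_le_right d ((y - p) / 2)
  set e := min d ((y - p) / 2)
  have hn : (K + 1) * (p + e - p) < z - (p + e) := by simpa using hdn e h0.le h1
  have h4 : Serves (F p (p + e) z) p :=
    (h.truthful₁ (p + e) z).serves (hp e h0 (by linarith))
  exact hc.not_loses_of_serves hn h4 le_rfl (by linarith) (hc.loses_of_le (by linarith) hw)

/-- If the second agent wins against the first one from the right, then she wins against the third
one from the left when the first agent is far away. -/
theorem wins_mirror (h : ThreeAgent F K) {z x₀ x : ℝ} (hw : Wins F K z x₀)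
    (hx : (K + 1) * (z - x₀) < x₀ - x) : Wins (TwoFacility.mirror F) K (-x) (-z) := by
  have hz := h.lt_of_wins hw
  have hx₀ : x < x₀ := by
    have := mul_pos (show 0 < K + 1 by linarith [h.nonneg]) (sub_pos.2 hz)
    linarith
  have hs := h.serves_of_wins hw hx₀ le_rfl
  have hs' : Serves (TwoFacility.mirror F (-z) (-x₀) (-x)) (-x₀) := by
    simpa [TwoFacility.mirror, serves_refl] using hs
  exact (h.mirror.contest (-x)).loses_of_serves (neg_lt_neg hz) (by linarith) hs' (neg_lt_neg hz)
    le_rfl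

/-- The second agent wins against the first one nowhere or everywhere. -/
theorem wins_of_wins (h : ThreeAgent F K) {z x₀ x : ℝ} (hw : Wins F K z x₀) (hx : x < z) :
    Wins F K z x := by
  by_contra hnx
  have hc := h.contest z
  have hK := h.nonneg
  set S : Set ℝ := {s | Wins F K z s}
  have hne : S.Nonempty := ⟨x₀, hw⟩
  have hle : ∀ s ∈ S, s ≤ x := fun s hs => by
    by_contra hxs
    exact hnx (hc.loses_of_le (not_le.1 hxs).le hs)
  have hbd : BddAbove S := ⟨x, hle⟩
  have ha : sSup S < z := (csSup_le hne hle).trans_lt hx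
  have hbelow : ∀ s, s < sSup S → Wins F K z s := fun s hs => by
    obtain ⟨t, ht, hst⟩ := exists_lt_of_lt_csSup hne hs
    exact hc.loses_of_le hst.le ht
  have habove : ∀ s, sSup S < s → ¬ Wins F K z s := fun s hs hws =>
    absurd (le_csSup hbd hws) (not_le.2 hs)
  -- The threshold `a` separates winning from non-winning positions. Agents on its two sides are
  -- forced to share a facility exactly at `a`.
  set a := sSup S
  obtain ⟨e, he, heK⟩ : ∃ e, 0 < e ∧ 2 * (K + 2) * e < z - a := by
    refine ⟨(z - a) / (4 * (K + 2)), by apply div_pos <;> linarith, ?_⟩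
    rw [mul_div_assoc', div_lt_iff₀ (by linarith)]
    nlinarith
  obtain ⟨e', he', heK', hee⟩ : ∃ e', 0 < e' ∧ (K + 1) * e' < e ∧ e' ≤ e := by
    have : e / (K + 2) * (K + 2) = e := div_mul_cancel₀ _ (by linarith)
    have hp : 0 < e / (K + 2) := div_pos he (by linarith)
    exact ⟨e / (K + 2), hp, by nlinarith, by nlinarith⟩
  have hlt : a - e' < a + e := by linarith
  have hn : (K + 1) * (a + e - (a - e')) < z - (a + e) := by nlinarith
  obtain ⟨u, hu1, hu2, hu, -, huc⟩ := hc.near_facility hlt hn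
  have hua : u = a := by
    rcases lt_trichotomy u a with hlt' | rfl | hgt
    · exact absurd (hbelow u hlt') (hc.not_loses_of_serves hn hu hu1 (by linarith))
    · rfl
    · have hm : Serves (F ((a + u) / 2) (a + e) z) ((a + u) / 2) := by
        by_contra hns
        exact habove ((a + u) / 2) (by linarith)
          ⟨a + e, by linarith, hc.near_mono hn (by linarith) le_rfl, hns⟩
      have h1 := (h.truthful₁ (a + e) z (a - e') ((a + u) / 2)).trans (hm.cost_le _)
      rw [huc _ le_rfl hlt.le, abs_of_pos (by linarith), abs_of_pos (by linarith)] at h1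
      linarith
  subst hua
  -- The third agent can move onto `a` and so beats the first one too. Reflecting both victories
  -- makes the second and third agents beat each other, which `not_wins_swap` forbids.
  have hs : Serves (F (a - e') (a + e) a) a := (h.truthful₃ (a - e') (a + e)).serves hu
  have hw' : Wins (fun x y z => F x z y) K (a + e) (a - e') :=
    (h.swap₂₃.contest (a + e)).loses_of_serves (y := a) (u := a) (by linarith)
      (by simpa using heK') hs (by linarith) le_rfl
  set y := min (x₀ - (K + 1) * (z - x₀)) (a - e' - (K + 1) * (a + e - (a - e'))) - 1
  have h1 := min_le_left (x₀ - (K + 1) * (z - x₀)) (a - e' - (K + 1) * (a + e - (a - e')))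
  have h2 := min_le_right (x₀ - (K + 1) * (z - x₀)) (a - e' - (K + 1) * (a + e - (a - e')))
  exact h.mirror.not_wins_swap (h.wins_mirror (x := y) hw (by linarith))
    (h.swap₂₃.wins_mirror (x := y) hw' (by linarith))

/-- If the second agent wins once, then she wins always. -/
theorem wins_of_wins' (h : ThreeAgent F K) {z x₀ z' x : ℝ} (hw : Wins F K z x₀) (hx : x < z') :
    Wins F K z' x := by
  have hK := h.nonneg
  -- Two reflections, with the first agent far away at `y` in between, move the third agent from `z`
  -- to `z'`.
  set y := min (x₀ - (K + 1) * (z - x₀)) z' - 1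
  have h1 := min_le_left (x₀ - (K + 1) * (z - x₀)) z'
  have h2 := min_le_right (x₀ - (K + 1) * (z - x₀)) z'
  have hw1 : Wins (TwoFacility.mirror F) K (-y) (-z) := h.wins_mirror hw (by linarith)
  have he : 0 < (z' - y) / (K + 3) := div_pos (by linarith) (by linarith)
  have hK3 : (z' - y) / (K + 3) * (K + 3) = z' - y := div_mul_cancel₀ _ (by linarith)
  have hw2 := h.mirror.wins_of_wins (x := -y - (z' - y) / (K + 3)) hw1 (by linarith)
  have hw3 := h.mirror.wins_mirror (x := -z') hw2 (by linarith)
  rw [mirror_mirror, neg_neg, neg_neg] at hw3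
  exact h.wins_of_wins hw3 hx

/-- If the second agent wins once, then she is served whenever she is in the middle. -/
theorem serves_middle (h : ThreeAgent F K) {z x₀ : ℝ} (hw : Wins F K z x₀) {x y z' : ℝ}
    (hxy : x < y) (hyz : y < z') : Serves (F x y z') y :=
  h.serves_of_wins (h.wins_of_wins' hw hyz) hxy le_rfl

/-- If the second agent never wins, then the leftmost agent is always served. -/
theorem serves_left (h : ThreeAgent F K) (hw : ∀ z x, ¬ Wins F K z x) {x y z : ℝ}
    (hxy : x < y) (hyz : y < z) : Serves (F x y z) x := by
  by_contra hns
  have hc := h.contest z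
  obtain ⟨p, hpy, hxp, hp⟩ := (h.truthful₁ y z).exists_right_end hxy
    ((h.truthful₁ y z).serves (hc.diag y hyz)) hns
  have hK := h.nonneg
  have hpos : 0 < (z - p) / (K + 2) := div_pos (by linarith) (by linarith)
  have hK2 : (z - p) / (K + 2) * (K + 2) = z - p := div_mul_cancel₀ _ (by linarith)
  have h0 : 0 < min ((z - p) / (K + 2)) ((p - x) / 2) := lt_min hpos (by linarith)
  have h1 := min_le_left ((z - p) / (K + 2)) ((p - x) / 2)
  have h2 := min_le_right ((z - p) / (K + 2)) ((p - x) / 2)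
  set e := min ((z - p) / (K + 2)) ((p - x) / 2)
  have hs : Serves (F (p - e) p z) p := (h.truthful₂ (p - e) z).serves (hp e h0 (by linarith))
  refine hw z (p - e) (hc.loses_of_serves (by linarith) ?_ hs (by linarith) le_rfl)
  nlinarith

end ThreeAgent
-- Four agents: the outer agents cannot both be served from the inside.
/-- A strategy-proof mechanism for four agents with approximation ratio at most `K`. -/
structure FourAgent (H : ℝ → ℝ → ℝ → ℝ → ℝ × ℝ) (K : ℝ) : Prop where
  truthful₁ : ∀ a b r, Truthful fun l => H l a b r
  truthful₂ : ∀ l b r, Truthful fun a => H l a b r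
  truthful₃ : ∀ l a r, Truthful fun b => H l a b r
  truthful₄ : ∀ l a b, Truthful fun r => H l a b r
  bounded : ∀ l a b r p t, t = l ∨ t = a ∨ t = b ∨ t = r →
    cost (H l a b r) t ≤ K * (cost p l + cost p a + cost p b + cost p r)
  nonneg : 0 ≤ K

/-- The mechanism `H` seen in a mirror. -/
def mirror₄ (H : ℝ → ℝ → ℝ → ℝ → ℝ × ℝ) (l a b r : ℝ) : ℝ × ℝ := refl (H (-r) (-b) (-a) (-l))

theorem serves_mirror₄ {H : ℝ → ℝ → ℝ → ℝ → ℝ × ℝ} {l a b r t : ℝ} :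
    Serves (mirror₄ H (-r) (-b) (-a) (-l)) (-t) ↔ Serves (H l a b r) t := by
  simp [mirror₄, serves_refl]

namespace FourAgent

variable {H : ℝ → ℝ → ℝ → ℝ → ℝ × ℝ} {K : ℝ}

theorem mirror (h : FourAgent H K) : FourAgent (mirror₄ H) K where
  truthful₁ _ _ _ := (h.truthful₄ _ _ _).reflect
  truthful₂ _ _ _ := (h.truthful₃ _ _ _).reflect
  truthful₃ _ _ _ := (h.truthful₂ _ _ _).reflect
  truthful₄ _ _ _ := (h.truthful₁ _ _ _).reflect
  bounded l a b r p t ht := by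
    have := h.bounded (-r) (-b) (-a) (-l) (refl p) (-t) (by
      rcases ht with rfl | rfl | rfl | rfl <;> simp)
    simp only [cost_refl, neg_neg] at this
    rw [mirror₄, cost_refl]
    linarith
  nonneg := h.nonneg

theorem merge₁₂ (h : FourAgent H K) : ThreeAgent (fun x y z => H x x y z) (2 * K) where
  truthful₁ _ _ s t := (h.truthful₁ _ _ _ s t).trans (h.truthful₂ _ _ _ s t)
  truthful₂ _ _ := h.truthful₃ _ _ _
  truthful₃ _ _ := h.truthful₄ _ _ _
  bounded x y z p t ht := by
    refine (h.bounded x x y z p t (by tauto)).trans ?_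
    nlinarith [h.nonneg, mul_nonneg h.nonneg (cost_nonneg p x), mul_nonneg h.nonneg
      (cost_nonneg p y), mul_nonneg h.nonneg (cost_nonneg p z)]
  nonneg := by linarith [h.nonneg]

theorem merge₂₃ (h : FourAgent H K) : ThreeAgent (fun x y z => H x y y z) (2 * K) where
  truthful₁ _ _ := h.truthful₁ _ _ _
  truthful₂ _ _ s t := (h.truthful₂ _ _ _ s t).trans (h.truthful₃ _ _ _ s t)
  truthful₃ _ _ := h.truthful₄ _ _ _
  bounded x y z p t ht := by
    refine (h.bounded x y y z p t (by tauto)).trans ?_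
    nlinarith [h.nonneg, mul_nonneg h.nonneg (cost_nonneg p x), mul_nonneg h.nonneg
      (cost_nonneg p y), mul_nonneg h.nonneg (cost_nonneg p z)]
  nonneg := by linarith [h.nonneg]

theorem merge₂₄ (h : FourAgent H K) : ThreeAgent (fun x y z => H x y z y) (2 * K) where
  truthful₁ _ _ := h.truthful₁ _ _ _
  truthful₂ _ _ s t := (h.truthful₂ _ _ _ s t).trans (h.truthful₄ _ _ _ s t)
  truthful₃ _ _ := h.truthful₃ _ _ _
  bounded x y z p t ht := by
    refine (h.bounded x y z y p t (by tauto)).trans ?_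
    nlinarith [h.nonneg, mul_nonneg h.nonneg (cost_nonneg p x), mul_nonneg h.nonneg
      (cost_nonneg p y), mul_nonneg h.nonneg (cost_nonneg p z)]
  nonneg := by linarith [h.nonneg]

/-- A facility `u` between the first agent and the third one that is the nearest one to the first
agent stays there when the first agent comes close to `u`. -/
theorem exists_near_serves (h : FourAgent H K) {l a b r u M z : ℝ} (hu : Serves (H l a b r) u)
    (hc : cost (H l a b r) l = u - l) (hlu : l < u) (hz : u < z) (hM : 0 < M) :
    ∃ t, t < u ∧ M * (u - t) < z - u ∧ Serves (H t a b r) u := by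
  have hp : 0 < (z - u) / (M + 1) := div_pos (by linarith) (by linarith)
  have hd : (z - u) / (M + 1) * (M + 1) = z - u := div_mul_cancel₀ _ (by linarith)
  have h0 : 0 < min ((z - u) / (M + 1)) ((u - l) / 2) := lt_min hp (by linarith)
  have h1 := min_le_left ((z - u) / (M + 1)) ((u - l) / 2)
  have h2 := min_le_right ((z - u) / (M + 1)) ((u - l) / 2)
  set e := min ((z - u) / (M + 1)) ((u - l) / 2)
  refine ⟨u - e, by linarith, by nlinarith, ?_⟩
  exact (h.truthful₁ a b r).serves_of_between hu hc (by linarith) (by linarith)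

/-- Once the first agent is close to `u`, the second and third can both move onto `u` without
displacing the facility. As a merged agent they beat the first one, with the fourth agent as the
distant one. -/
theorem serves_middle₂₃ (h : FourAgent H K) {l a b r u : ℝ} (hu : Serves (H l a b r) u)
    (hc : cost (H l a b r) l = u - l) (hlu : l < u) (hur : u < r) {x y z : ℝ} (hxy : x < y)
    (hyz : y < z) : Serves (H x y y z) y := by
  obtain ⟨t, htu, hn, ht⟩ := h.exists_near_serves hu hc hlu hur
    (show 0 < 2 * K + 1 by linarith [h.nonneg])
  have hw : Wins (fun x y z => H x y y z) (2 * K) r t :=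
    (h.merge₂₃.contest r).loses_of_serves htu hn
      ((h.truthful₃ t u r).serves ((h.truthful₂ t b r).serves ht)) htu le_rfl
  exact h.merge₂₃.serves_middle hw hxy hyz

/-- Here the second and fourth agents move onto `u` and the third one, at `b`, is the distant agent;
hence the requirement `u < b`. -/
theorem serves_middle₂₄ (h : FourAgent H K) {l a b r u : ℝ} (hu : Serves (H l a b r) u)
    (hc : cost (H l a b r) l = u - l) (hlu : l < u) (hub : u < b) {x y z : ℝ} (hxy : x < y)
    (hyz : y < z) : Serves (H x y z y) y := by
  obtain ⟨t, htu, hn, ht⟩ := h.exists_near_serves hu hc hlu hub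
    (show 0 < 2 * K + 1 by linarith [h.nonneg])
  have hw : Wins (fun x y z => H x y z y) (2 * K) b t :=
    (h.merge₂₄.contest b).loses_of_serves htu hn
      ((h.truthful₄ t u b).serves ((h.truthful₂ t b r).serves ht)) htu le_rfl
  exact h.merge₂₄.serves_middle hw hxy hyz

/-- With the last two agents fixed, the first two compete against each other, provided that they
are served when they are together. -/
theorem contest (h : FourAgent H K) {b r : ℝ} (hbr : b < r)
    (hd : ∀ x, x < b → Serves (H x x b r) x) : Contest (fun x y => H x y b r) b (K + 1) where
  truthful_left y := h.truthful₁ y b r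
  truthful_right x := h.truthful₂ x b r
  diag := hd
  far x y hxy _ := by
    have h1 := h.bounded x y b b (x, b) b (by simp)
    have h2 : cost (x, b) x = 0 := Serves.cost_eq_zero (Or.inl rfl)
    have h3 : cost (x, b) b = 0 := Serves.cost_eq_zero (Or.inr rfl)
    have h4 : cost (x, b) y ≤ |x - y| := Serves.cost_le (Or.inl rfl) y
    rw [abs_of_neg (by linarith)] at h4
    -- With the fourth agent moved onto `b`, facilities at `x` and `b` cost only `y - x`;
    -- truthfulness carries the estimate back to `r` at the extra price `r - b`.
    have h5 := (h.truthful₄ x y b).cost_le_add r b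
    rw [abs_of_pos (by linarith)] at h5
    have h6 : cost (H x y b b) b ≤ K * (y - x) :=
      h1.trans (mul_le_mul_of_nonneg_left (by linarith) h.nonneg)
    obtain ⟨w, hw, hw1, -⟩ := exists_serves_of_cost_le (h5.trans (add_le_add_left h6 _))
    exact ⟨w, hw, by linarith⟩
  nonneg := by linarith [h.nonneg]

/-- If the third agent wins against the second one, then so does the second one against the
first one. -/
theorem loses (h : FourAgent H K) (h₂₃ : ∀ {x y z}, x < y → y < z → Serves (H x y y z) y)
    (hd : ∀ x, x < 0 → Serves (H x x 0 1) x) {x : ℝ} (hx : x < 0) :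
    Loses (fun x y => H x y 0 1) 0 (K + 1) x := by
  have hK := h.nonneg
  have hc := h.contest one_pos hd
  have hp : 0 < 1 / (2 * K + 2) := by positivity
  have hp2 : 1 / (2 * K + 2) * (2 * K + 2) = 1 := div_mul_cancel₀ _ (by linarith)
  have h0 : 0 < min (1 / (2 * K + 2)) (-x) := lt_min hp (by linarith)
  have h1 := min_le_left (1 / (2 * K + 2)) (-x)
  have h2 := min_le_right (1 / (2 * K + 2)) (-x)
  set e := min (1 / (2 * K + 2)) (-x)
  have he : e * (2 * K + 2) ≤ 1 := by nlinarith
  have hp' : 0 < e / (K + 3) := by positivity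
  have hq : e / (K + 3) * (K + 3) = e := div_mul_cancel₀ _ (by linarith)
  set d := e / (K + 3)
  refine hc.loses_of_le (x := -e) (by linarith) ⟨-e + d, by linarith, by nlinarith, fun hs => ?_⟩
  have hde : d < e := by nlinarith
  have c1 : cost (H (-e) (-e + d) 0 1) 0 ≤ e - d := by
    refine (h.truthful₃ _ _ _ 0 (-e + d)).trans
      (((h₂₃ (by linarith) (by linarith)).cost_le 0).trans_eq ?_)
    rw [abs_of_neg (by linarith)]; ring
  have c2 : cost (H (-e) (-e + d) 0 1) (-e) ≤ d := by
    refine (h.truthful₁ _ _ _ (-e) (-e + d)).trans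
      (((hd _ (by linarith)).cost_le (-e)).trans_eq ?_)
    rw [abs_of_pos (by linarith)]; ring
  have c3 : cost (H (-e) (-e + d) 0 1) 1 ≤ K * (2 * e) := by
    refine (h.bounded _ _ _ _ (0, 1) 1 (by simp)).trans (mul_le_mul_of_nonneg_left ?_ hK)
    have b1 : cost (0, 1) (-e) ≤ |0 - -e| := Serves.cost_le (Or.inl rfl) _
    have b2 : cost (0, 1) (-e + d) ≤ |0 - (-e + d)| := Serves.cost_le (Or.inl rfl) _
    have b3 : cost (0, 1) 0 = 0 := Serves.cost_eq_zero (Or.inl rfl)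
    have b4 : cost (0, 1) 1 = 0 := Serves.cost_eq_zero (Or.inr rfl)
    rw [abs_of_pos (by linarith)] at b1 b2
    linarith
  obtain ⟨q₁, hq₁, hq₁l, hq₁r⟩ := exists_serves_of_cost_le c1
  obtain ⟨q₂, hq₂, hq₂l, hq₂r⟩ := exists_serves_of_cost_le c2
  obtain ⟨q₃, hq₃, hq₃l, -⟩ := exists_serves_of_cost_le c3
  have h13 : q₁ < q₃ := by nlinarith
  -- The third agent needs a facility at `-e + d` or to the right, the first one at `-e + d` or to
  -- the left. As `q₃` is too far right for both, the other facility is exactly at `-e + d`, and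
  -- `-e` is not served.
  have h12 : q₂ = q₁ := (hq₁.eq_or_eq hq₃ h13.ne hq₂).resolve_right (by linarith)
  rcases hq₁.eq_or_eq hq₃ h13.ne hs with e1 | e1 <;> linarith

/-- The third agent is served when she is in the middle. -/
theorem serves_middle₁₂ (h : FourAgent H K) (h₂₃ : ∀ {x y z}, x < y → y < z → Serves (H x y y z) y)
    (h₁₃ : ∀ {x y z}, x < y → y < z → Serves (H y x y z) y) {x y z : ℝ} (hxy : x < y)
    (hyz : y < z) : Serves (H x x y z) y := by
  by_cases hw : ∃ z x, Wins (fun x y z => H x x y z) (2 * K) z x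
  · obtain ⟨z₀, x₀, hw⟩ := hw
    exact h.merge₁₂.serves_middle hw hxy hyz
  push Not at hw
  -- If the merged pair is never beaten, agents 1 and 2 can duel with the others at `0` and `1`.
  -- Then the profile `0, -e, 0, 1` needs facilities at `-e`, at `0` and near `1`.
  have hK := h.nonneg
  have hd : ∀ x, x < 0 → Serves (H x x 0 1) x := fun x hx => h.merge₁₂.serves_left hw hx one_pos
  have hp : 0 < 1 / (2 * K + 2) := by positivity
  have hp2 : 1 / (2 * K + 2) * (2 * K + 2) = 1 := div_mul_cancel₀ _ (by linarith)
  set e := 1 / (2 * K + 2)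
  have b1 : cost (-e - K - 1, (0 : ℝ)) 1 ≤ |0 - 1| := Serves.cost_le (Or.inr rfl) _
  have b2 : cost (-e - K - 1, (0 : ℝ)) 0 = 0 := Serves.cost_eq_zero (Or.inr rfl)
  have b3 : cost (-e - K - 1, (0 : ℝ)) (-e - K - 1) = 0 := Serves.cost_eq_zero (Or.inl rfl)
  have c1 : cost (H 0 (-e - K - 1) 0 1) (-e - K - 1) ≤ K * 1 := by
    refine (h.bounded _ _ _ _ (-e - K - 1, 0) _ (by simp)).trans
      (mul_le_mul_of_nonneg_left ?_ hK)
    norm_num at b1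
    linarith
  obtain ⟨s, hs, -, hs2⟩ := exists_serves_of_cost_le c1
  have hy : Serves (H 0 (-e) 0 1) (-e) :=
    (h.contest one_pos hd).serves_of_forall_loses (Z' := 0) le_rfl (fun t ht => h.loses h₂₃ hd ht)
      ⟨s, by linarith, (h.truthful₂ 0 0 1).serves hs⟩ (by linarith)
  have h0 : Serves (H 0 (-e) 0 1) 0 := h₁₃ (by linarith) one_pos
  have c2 : cost (H 0 (-e) 0 1) 1 ≤ K * e := by
    refine (h.bounded _ _ _ _ (0, 1) 1 (by simp)).trans (mul_le_mul_of_nonneg_left ?_ hK)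
    have d1 : cost (0, 1) (-e) ≤ |0 - -e| := Serves.cost_le (Or.inl rfl) _
    have d2 : cost (0, 1) 0 = 0 := Serves.cost_eq_zero (Or.inl rfl)
    have d3 : cost (0, 1) 1 = 0 := Serves.cost_eq_zero (Or.inr rfl)
    rw [abs_of_pos (by linarith)] at d1
    linarith
  obtain ⟨q, hq, hql, -⟩ := exists_serves_of_cost_le c2
  have hq0 : 0 < q := by nlinarith
  rcases hy.eq_or_eq h0 (by linarith) hq with e1 | e1 <;> linarith

/-- The second agent is served when the agents are in order. -/
theorem serves_second (h : FourAgent H K) (h₂₃ : ∀ {x y z}, x < y → y < z → Serves (H x y y z) y)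
    (h₃₄ : ∀ {x y z}, x < y → y < z → Serves (H x y z z) y) {l a b r : ℝ} (hla : l < a)
    (hab : a < b) (hbr : b < r) : Serves (H l a b r) a := by
  by_contra hns
  obtain ⟨q, hqb, haq, hq⟩ := (h.truthful₂ l b r).exists_right_end hab
    (h₂₃ (hla.trans hab) hbr) hns
  have hK := h.nonneg
  have hp : 0 < (q - l) / (K + 2) := div_pos (by linarith) (by linarith)
  have hp2 : (q - l) / (K + 2) * (K + 2) = q - l := div_mul_cancel₀ _ (by linarith)
  have h0 : 0 < min ((q - l) / (K + 2)) ((q - a) / 2) := lt_min hp (by linarith)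
  have h1 := min_le_left ((q - l) / (K + 2)) ((q - a) / 2)
  have h2 := min_le_right ((q - l) / (K + 2)) ((q - a) / 2)
  set η := min ((q - l) / (K + 2)) ((q - a) / 2)
  -- The last two agents gather at the gap's edge `q`. Now `q` and `q - η` are both served, while
  -- the bound on `η` makes the agent at `l` need a third facility.
  have hs : Serves (H l (q - η) q q) q := (h.truthful₄ _ _ _).serves
    ((h.truthful₃ _ _ _).serves (hq η h0 (by linarith)))
  have hs' : Serves (H l (q - η) q q) (q - η) := h₃₄ (by linarith) (by linarith)
  have c : cost (H l (q - η) q q) l ≤ K * η := by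
    refine (h.bounded _ _ _ _ (l, q) _ (by simp)).trans (mul_le_mul_of_nonneg_left ?_ hK)
    have d1 : cost (l, q) (q - η) ≤ |q - (q - η)| := Serves.cost_le (Or.inr rfl) _
    have d2 : cost (l, q) l = 0 := Serves.cost_eq_zero (Or.inl rfl)
    have d3 : cost (l, q) q = 0 := Serves.cost_eq_zero (Or.inr rfl)
    rw [abs_of_pos (by linarith)] at d1
    linarith
  obtain ⟨w, hw, -, hw2⟩ := exists_serves_of_cost_le c
  rcases hs.eq_or_eq hs' (by linarith) hw with e1 | e1 <;> nlinarith

/-- It is impossible that both outer agents are served from the inside, each by a facility that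
lies on her side of the more distant one of the two inner agents. -/
theorem not_serves_inside (h : FourAgent H K) {l a b r u v : ℝ} (hu : Serves (H l a b r) u)
    (huc : cost (H l a b r) l = u - l) (hlu : l < u) (hub : u < b) (hv : Serves (H l a b r) v)
    (hvc : cost (H l a b r) r = r - v) (hvr : v < r) (hav : a < v) (hbr : b < r) : False := by
  have hu' := serves_mirror₄.2 hv
  have huc' : cost (mirror₄ H (-r) (-b) (-a) (-l)) (-r) = -v - -r := by
    rw [mirror₄, cost_refl]; simp only [neg_neg]; linarith
  have h₂₃ : ∀ {x y z}, x < y → y < z → Serves (H x y y z) y := fun hxy hyz =>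
    h.serves_middle₂₃ hu huc hlu (hub.trans hbr) hxy hyz
  have h₂₄ : ∀ {x y z}, x < y → y < z → Serves (H x y z y) y := fun hxy hyz =>
    h.serves_middle₂₄ hu huc hlu hub hxy hyz
  have h₁₃ : ∀ {x y z}, x < y → y < z → Serves (H y x y z) y := fun hxy hyz =>
    serves_mirror₄.1 (h.mirror.serves_middle₂₄ hu' huc' (by linarith) (by linarith)
      (neg_lt_neg hyz) (neg_lt_neg hxy))
  have h₂₃' : ∀ {x y z}, x < y → y < z → Serves (mirror₄ H x y y z) y := fun hxy hyz => by
    simpa [mirror₄, serves_refl] using h₂₃ (neg_lt_neg hyz) (neg_lt_neg hxy)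
  have h₁₃' : ∀ {x y z}, x < y → y < z → Serves (mirror₄ H y x y z) y := fun hxy hyz => by
    simpa [mirror₄, serves_refl] using h₂₄ (neg_lt_neg hyz) (neg_lt_neg hxy)
  have h₁₂ : ∀ {x y z}, x < y → y < z → Serves (H x x y z) y := fun hxy hyz =>
    h.serves_middle₁₂ h₂₃ h₁₃ hxy hyz
  have h₃₄ : ∀ {x y z}, x < y → y < z → Serves (H x y z z) y := fun hxy hyz =>
    serves_mirror₄.1 (h.mirror.serves_middle₁₂ h₂₃' h₁₃' (neg_lt_neg hyz) (neg_lt_neg hxy))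
  have h₃₄' : ∀ {x y z}, x < y → y < z → Serves (mirror₄ H x y z z) y := fun hxy hyz => by
    simpa [mirror₄, serves_refl] using h₁₂ (neg_lt_neg hyz) (neg_lt_neg hxy)
  have hK := h.nonneg
  -- Facilities at `1` and `2` leave the last agent at distance `2 * K + 1`, but the optimum is at
  -- most `2`.
  have s1 : Serves (H 0 1 2 (2 * K + 3)) 1 :=
    h.serves_second h₂₃ h₃₄ (by norm_num) (by norm_num) (by linarith)
  have s2 : Serves (H 0 1 2 (2 * K + 3)) 2 := serves_mirror₄.1
    (h.mirror.serves_second h₂₃' h₃₄' (by linarith) (by norm_num) (by norm_num))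
  have c : cost (H 0 1 2 (2 * K + 3)) (2 * K + 3) ≤ K * 2 := by
    refine (h.bounded _ _ _ _ (1, 2 * K + 3) _ (by simp)).trans (mul_le_mul_of_nonneg_left ?_ hK)
    have d1 : cost (1, 2 * K + 3) 0 ≤ |1 - 0| := Serves.cost_le (Or.inl rfl) _
    have d2 : cost (1, 2 * K + 3) 1 = 0 := Serves.cost_eq_zero (Or.inl rfl)
    have d3 : cost (1, 2 * K + 3) 2 ≤ |1 - 2| := Serves.cost_le (Or.inl rfl) _
    have d4 : cost (1, 2 * K + 3) (2 * K + 3) = 0 := Serves.cost_eq_zero (Or.inr rfl)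
    norm_num at d1 d3
    linarith
  obtain ⟨q, hq, hql, -⟩ := exists_serves_of_cost_le c
  rcases s1.eq_or_eq s2 (by norm_num) hq with e1 | e1 <;> linarith

end FourAgent

/-! ### From `n` agents to four groups. -/

variable {n : ℕ}

/-- Co-located agents cannot benefit from a joint misreport. -/
theorem StrategyProof.cost_le_of_agree {g : Mechanism n} (hg : StrategyProof g)
    (S : Finset (Fin n)) {y y' : Profile n} {t : ℝ} (hy : ∀ i ∈ S, y i = t)
    (hyy : ∀ i, i ∉ S → y i = y' i) : cost (g y) t ≤ cost (g y') t := by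
  induction S using Finset.induction_on generalizing y with
  | empty => rw [funext fun i => hyy i (by simp)]
  | insert i S hi ih =>
    have h1 := hg y i (y' i)
    rw [hy i (by simp)] at h1
    refine h1.trans (ih (fun j hj => ?_) fun j hj => ?_)
    · rw [Function.update_of_ne (by rintro rfl; exact hi hj)]
      exact hy j (by simp [hj])
    · rcases eq_or_ne j i with rfl | hne
      · simp
      · rw [Function.update_of_ne hne]
        exact hyy j (by simp [hne, hj])

theorem totalCost_nonneg (l : ℝ × ℝ) (x : Profile n) : 0 ≤ totalCost l x :=
  Finset.sum_nonneg fun _ _ => cost_nonneg _ _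

theorem bddBelow_totalCost (x : Profile n) : BddBelow (Set.range fun l => totalCost l x) :=
  ⟨0, by rintro _ ⟨l, rfl⟩; exact totalCost_nonneg l x⟩

theorem HasApproxRatio.cost_le {g : Mechanism n} {ρ : ℝ} (hg : HasApproxRatio g ρ) (p : ℝ × ℝ)
    (y : Profile n) (i : Fin n) : cost (g y) (y i) ≤ max ρ 0 * totalCost p y :=
  calc cost (g y) (y i) ≤ totalCost (g y) y :=
        Finset.single_le_sum (f := fun i => cost (g y) (y i)) (fun _ _ => cost_nonneg _ _)
          (Finset.mem_univ i)
    _ ≤ ρ * OPT y := hg y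
    _ ≤ max ρ 0 * OPT y := mul_le_mul_of_nonneg_right (le_max_left _ _)
        (Real.iInf_nonneg fun _ => totalCost_nonneg _ _)
    _ ≤ max ρ 0 * totalCost p y := mul_le_mul_of_nonneg_left
        (ciInf_le (bddBelow_totalCost y) p) (le_max_right _ _)

/-- Four groups of agents with common reports form a mechanism for four agents. -/
theorem StrategyProof.fourAgent {g : Mechanism n} {ρ : ℝ} (hg : StrategyProof g)
    (hρ : HasApproxRatio g ρ) {c : Fin n → Fin 4} (hc : Function.Surjective c) :
    FourAgent (fun l a b r => g fun i => ![l, a, b, r] (c i)) (max ρ 0 * n) := by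
  have key : ∀ (k : Fin 4) (v v' : Fin 4 → ℝ), (∀ j, j ≠ k → v j = v' j) →
      cost (g fun i => v (c i)) (v k) ≤ cost (g fun i => v' (c i)) (v k) := fun k v v' hv =>
    hg.cost_le_of_agree (Finset.univ.filter fun i => c i = k)
      (fun i hi => by rw [(Finset.mem_filter.1 hi).2])
      fun i hi => hv _ fun h => hi (Finset.mem_filter.2 ⟨Finset.mem_univ i, h⟩)
  refine ⟨fun a b r s t => key 0 ![s, a, b, r] ![t, a, b, r] ?_,
    fun l b r s t => key 1 ![l, s, b, r] ![l, t, b, r] ?_,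
    fun l a r s t => key 2 ![l, a, s, r] ![l, a, t, r] ?_,
    fun l a b s t => key 3 ![l, a, b, s] ![l, a, b, t] ?_, fun l a b r p t ht => ?_,
    mul_nonneg (le_max_right _ _) n.cast_nonneg⟩
  iterate 4 (intro j hj; fin_cases j <;> simp_all)
  obtain ⟨k, rfl⟩ : ∃ k, ![l, a, b, r] k = t := by
    rcases ht with rfl | rfl | rfl | rfl
    exacts [⟨0, rfl⟩, ⟨1, rfl⟩, ⟨2, rfl⟩, ⟨3, rfl⟩]
  obtain ⟨i, rfl⟩ := hc k
  refine (hρ.cost_le p (fun i => ![l, a, b, r] (c i)) i).trans ?_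
  rw [mul_assoc]
  refine mul_le_mul_of_nonneg_left ?_ (le_max_right _ _)
  have h : ∀ k, cost p (![l, a, b, r] k) ≤ cost p l + cost p a + cost p b + cost p r := fun k => by
    have h1 := cost_nonneg p l
    have h2 := cost_nonneg p a
    have h3 := cost_nonneg p b
    have h4 := cost_nonneg p r
    fin_cases k <;> simp <;> linarith
  exact (Finset.sum_le_card_nsmul _ _ _ fun i _ => h (c i)).trans_eq (by simp; ring)

/-! ### Costs on cluster profiles. -/

/-- Either the cost is high or the two clusters have facilities of their own. -/
theorem exists_serves_clusters {m b ε : ℝ} (hm : 1 ≤ m) (hmb : m ≤ b) (hε : 0 < ε)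
    (hε4 : ε < 1 / 4) (l : ℝ × ℝ) :
    (m + 1) * ε ≤ cost l 0 + m * cost l ε + b * cost l (1 - ε) + cost l 1 ∨
    ∃ p q, Serves l p ∧ Serves l q ∧ cost l 0 = |p| ∧ cost l ε = |p - ε| ∧
      cost l (1 - ε) = |q - (1 - ε)| ∧ cost l 1 = |q - 1| := by
  obtain ⟨p, hp, hpc⟩ := exists_serves l ε
  obtain ⟨q, hq, hqc⟩ := exists_serves l (1 - ε)
  have h0 := cost_nonneg l 0
  have h1 := cost_nonneg l 1
  rcases eq_or_ne p q with rfl | hpq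
  -- One facility is nearest to both clusters, so each pair of agents from the two costs at least `1
  -- - 2 * ε`, which exceeds `2 * ε`.
  · left
    have h2 : 1 - 2 * ε ≤ cost l ε + cost l (1 - ε) := by
      rw [← hpc, ← hqc]
      linarith [le_abs_self (p - ε), neg_abs_le (p - (1 - ε))]
    nlinarith [mul_le_mul_of_nonneg_right hmb (cost_nonneg l (1 - ε))]
  · right
    have h2 : |p - ε| ≤ |q - ε| := hpc.trans_le (hq.cost_le ε)
    have h3 : |q - (1 - ε)| ≤ |p - (1 - ε)| := hqc.trans_le (hp.cost_le (1 - ε))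
    have h4 := sq_le_sq.2 h2
    have h5 := sq_le_sq.2 h3
    have hlt : p < q := by
      by_contra hle
      have : q < p := lt_of_le_of_ne (not_lt.1 hle) hpq.symm
      nlinarith
    have h6 : 2 * ε ≤ p + q := by nlinarith
    have h7 : p + q ≤ 2 * (1 - ε) := by nlinarith
    refine ⟨p, q, hp, hq, le_antisymm (by simpa using hp.cost_le 0) ?_, hpc.symm, hqc.symm,
      le_antisymm (hq.cost_le 1) ?_⟩
    · obtain ⟨w, hw, hwc⟩ := exists_serves l 0
      rw [← hwc, sub_zero]
      rcases hp.eq_or_eq hq hpq hw with rfl | rfl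
      · exact le_rfl
      · exact sq_le_sq.1 (by nlinarith)
    · obtain ⟨w, hw, hwc⟩ := exists_serves l 1
      rw [← hwc]
      rcases hp.eq_or_eq hq hpq hw with rfl | rfl
      · exact sq_le_sq.1 (by nlinarith)
      · exact le_rfl

theorem two_mul_le_cost {m b ε : ℝ} (hm : 1 ≤ m) (hmb : m ≤ b) (hε : 0 < ε) (hε4 : ε < 1 / 4)
    (l : ℝ × ℝ) : 2 * ε ≤ cost l 0 + m * cost l ε + b * cost l (1 - ε) + cost l 1 := by
  rcases exists_serves_clusters hm hmb hε hε4 l with h | ⟨p, q, -, -, h1, h2, h3, h4⟩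
  · nlinarith
  · have h5 := mul_le_mul_of_nonneg_right hm (cost_nonneg l ε)
    have h6 := mul_le_mul_of_nonneg_right (hm.trans hmb) (cost_nonneg l (1 - ε))
    rw [h2] at h5
    rw [h3] at h6
    rw [h1, h2, h3, h4]
    linarith [le_abs_self p, neg_abs_le (p - ε), le_abs_self (q - (1 - ε)), neg_abs_le (q - 1)]

/-- If the cost is low, then the facilities are strictly between `0` and `1`, close to the
clusters. -/
theorem exists_serves_of_cost_lt {m b ε : ℝ} (hm : 1 ≤ m) (hmb : m ≤ b) (hε : 0 < ε)
    (hε4 : ε < 1 / 4) {l : ℝ × ℝ}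
    (h : cost l 0 + m * cost l ε + b * cost l (1 - ε) + cost l 1 < (m + 1) * ε) :
    ∃ p q, Serves l p ∧ cost l 0 = p - 0 ∧ 0 < p ∧ p < 1 - ε ∧
      Serves l q ∧ cost l 1 = 1 - q ∧ q < 1 ∧ ε < q := by
  rcases exists_serves_clusters hm hmb hε hε4 l with h' | ⟨p, q, hp, hq, h1, h2, h3, h4⟩
  · exact absurd h (not_lt.2 h')
  have h5 := mul_le_mul_of_nonneg_right hm (cost_nonneg l ε)
  have h6 := mul_le_mul_of_nonneg_right (hm.trans hmb) (cost_nonneg l (1 - ε))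
  rw [h2] at h5
  rw [h3] at h6
  have h7 : ε ≤ |p| + |p - ε| := by linarith [le_abs_self p, neg_abs_le (p - ε)]
  have h8 : ε ≤ |q - (1 - ε)| + |q - 1| := by
    linarith [le_abs_self (q - (1 - ε)), neg_abs_le (q - 1)]
  rw [h1, h2, h3, h4] at h
  have h9 : |p - ε| < ε := by
    -- The right half of the profile already costs at least `ε`, which leaves less than `m * ε` for
    -- the left half.
    refine lt_of_mul_lt_mul_left (a := m) ?_ (by linarith)
    linarith [abs_nonneg p]
  have h10 : |q - (1 - ε)| < ε := by
    refine lt_of_mul_lt_mul_left (a := b) ?_ (by linarith)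
    nlinarith [abs_nonneg (q - 1)]
  rw [abs_lt] at h9 h10
  refine ⟨p, q, hp, ?_, by linarith, by linarith, hq, ?_, by linarith, by linarith⟩
  · rw [h1, abs_of_pos (by linarith), sub_zero]
  · rw [h4, abs_of_neg (by linarith), neg_sub]

namespace IsClusterProfile

variable {ε : ℝ} {x : Profile n}

theorem exists_groups (hx : IsClusterProfile ε x) (hn : 5 ≤ n) (hε : 0 < ε) (hε4 : ε < 1 / 4) :
    ∃ c : Fin n → Fin 4, (x = fun i => ![0, ε, 1 - ε, 1] (c i)) ∧ Function.Surjective c ∧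
      ∀ l, totalCost l x = cost l 0 + ((n / 2 - 1 : ℕ) : ℝ) * cost l ε +
        ((n - n / 2 - 1 : ℕ) : ℝ) * cost l (1 - ε) + cost l 1 := by
  obtain ⟨h0, h1, h2, h3⟩ := hx
  have hcard : ∀ t : ℝ, {i | x i = t}.ncard = (Finset.univ.filter fun i => x i = t).card :=
    fun t => by rw [← Set.ncard_coe_finset]; simp
  simp only [hcard] at h0 h1 h2 h3
  have hle : ∀ i ∈ Finset.univ, ((if x i = 0 then 1 else 0) + (if x i = 1 then 1 else 0) +
      (if x i = ε then 1 else 0) + (if x i = 1 - ε then 1 else 0) : ℕ) ≤ 1 := fun i _ => by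
    split_ifs <;> first | omega | (exfalso; linarith)
  -- The four group sizes add up to `n` and the groups are disjoint, so every agent belongs to one
  -- of them.
  have hsum := (Finset.sum_eq_sum_iff_of_le hle).1 (by
    simp only [Finset.sum_add_distrib, ← Finset.card_filter, h0, h1, h2, h3]
    simp
    omega)
  have hex : ∀ i, ∃ k : Fin 4, x i = ![0, ε, 1 - ε, 1] k := fun i => by
    have := hsum i (Finset.mem_univ i)
    by_contra! hne
    have e0 : x i ≠ 0 := hne 0
    have e1 : x i ≠ ε := hne 1
    have e2 : x i ≠ 1 - ε := hne 2
    have e3 : x i ≠ 1 := hne 3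
    simp [e0, e1, e2, e3] at this
  choose c hc using hex
  have hmono : StrictMono ![0, ε, 1 - ε, 1] := by
    rw [Fin.strictMono_iff_lt_succ]
    intro i
    fin_cases i <;> simp <;> linarith
  have hfilter : ∀ k, (Finset.univ.filter fun i => c i = k) =
      Finset.univ.filter fun i => x i = ![0, ε, 1 - ε, 1] k := fun k => by
    ext i; simp only [Finset.mem_filter, hc i, hmono.injective.eq_iff]
  have k0 : (Finset.univ.filter fun i => c i = 0).card = 1 := by rw [hfilter]; exact h0
  have k1 : (Finset.univ.filter fun i => c i = 1).card = n / 2 - 1 := by rw [hfilter]; exact h2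
  have k2 : (Finset.univ.filter fun i => c i = 2).card = n - n / 2 - 1 := by
    rw [hfilter]; exact h3
  have k3 : (Finset.univ.filter fun i => c i = 3).card = 1 := by rw [hfilter]; exact h1
  refine ⟨c, funext hc, fun k => ?_, fun l => ?_⟩
  · have : 0 < (Finset.univ.filter fun i => c i = k).card := by
      fin_cases k
      · exact k0 ▸ one_pos
      · refine k1.symm ▸ ?_; omega
      · refine k2.symm ▸ ?_; omega
      · exact k3 ▸ one_pos
    obtain ⟨i, hi⟩ := Finset.card_pos.1 this
    exact ⟨i, (Finset.mem_filter.1 hi).2⟩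
  · have : totalCost l x = ∑ i, cost l (![0, ε, 1 - ε, 1] (c i)) := by simp only [totalCost, hc]
    rw [this, ← Finset.sum_fiberwise Finset.univ c]
    have hk : ∀ k, ∑ i with c i = k, cost l (![0, ε, 1 - ε, 1] (c i)) =
        (Finset.univ.filter fun i => c i = k).card * cost l (![0, ε, 1 - ε, 1] k) := fun k => by
      rw [← nsmul_eq_mul]
      exact Finset.sum_eq_card_nsmul fun i hi => by rw [(Finset.mem_filter.1 hi).2]
    simp only [hk, Fin.sum_univ_four, k0, k1, k2, k3]
    simp

theorem opt_eq (hx : IsClusterProfile ε x) (hn : 5 ≤ n) (hε : 0 < ε) (hε4 : ε < 1 / 4) :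
    OPT x = 2 * ε := by
  obtain ⟨c, -, -, hc⟩ := hx.exists_groups hn hε hε4
  refine le_antisymm ((ciInf_le (bddBelow_totalCost x) (ε, 1 - ε)).trans ?_) (le_ciInf fun l => ?_)
  · have h0 : cost (ε, 1 - ε) 0 ≤ |ε - 0| := Serves.cost_le (Or.inl rfl) 0
    have h1 : cost (ε, 1 - ε) ε = 0 := Serves.cost_eq_zero (Or.inl rfl)
    have h2 : cost (ε, 1 - ε) (1 - ε) = 0 := Serves.cost_eq_zero (Or.inr rfl)
    have h3 : cost (ε, 1 - ε) 1 ≤ |1 - ε - 1| := Serves.cost_le (Or.inr rfl) 1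
    rw [abs_of_pos (by linarith)] at h0
    rw [abs_of_neg (by linarith)] at h3
    rw [hc, h1, h2]
    linarith
  · rw [hc]
    refine two_mul_le_cost ?_ ?_ hε hε4 l
    · exact_mod_cast (show 1 ≤ n / 2 - 1 by omega)
    · exact_mod_cast (show n / 2 - 1 ≤ n - n / 2 - 1 by omega)

theorem le_SC (hx : IsClusterProfile ε x) (hn : 5 ≤ n) (hε : 0 < ε) (hε4 : ε < 1 / 4)
    {g : Mechanism n} {ρ : ℝ} (hg : StrategyProof g) (hρ : HasApproxRatio g ρ) :
    ((n / 2 : ℕ) : ℝ) * ε ≤ SC g x := by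
  obtain ⟨c, hxc, hsurj, hc⟩ := hx.exists_groups hn hε hε4
  by_contra! hlt
  have hm : ((n / 2 : ℕ) : ℝ) = ((n / 2 - 1 : ℕ) : ℝ) + 1 := by
    exact_mod_cast (show n / 2 = n / 2 - 1 + 1 by omega)
  rw [SC, hc, hm] at hlt
  obtain ⟨p, q, hp, hpc, hp0, hp1, hq, hqc, hq1, hq0⟩ := exists_serves_of_cost_lt
    (by exact_mod_cast (show 1 ≤ n / 2 - 1 by omega))
    (by exact_mod_cast (show n / 2 - 1 ≤ n - n / 2 - 1 by omega)) hε hε4 hlt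
  rw [hxc] at hp hpc hq hqc
  exact (hg.fourAgent hρ hsurj).not_serves_inside hp hpc hp0 hp1 hq hqc hq1 hq0 (by linarith)

end IsClusterProfile

/-! ### Existence of cluster profiles and the consistency bound. -/

theorem ncard_fin_Ico {a b : ℕ} (hb : b ≤ n) :
    {i : Fin n | a ≤ (i : ℕ) ∧ (i : ℕ) < b}.ncard = b - a := by
  rw [← Set.ncard_image_of_injective _ Fin.val_injective]
  have : Fin.val '' {i : Fin n | a ≤ (i : ℕ) ∧ (i : ℕ) < b} = Set.Ico a b := by
    ext k
    simp only [Set.mem_image, Set.mem_ofPred_eq, Set.mem_Ico]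
    constructor
    · rintro ⟨i, hi, rfl⟩; exact hi
    · rintro hk; exact ⟨⟨k, by omega⟩, hk, rfl⟩
  rw [this, ← Finset.coe_Ico, Set.ncard_coe_finset, Nat.card_Ico]

theorem exists_isClusterProfile (hn : 5 ≤ n) {ε : ℝ} (hε : 0 < ε) (hε4 : ε < 1 / 4) :
    ∃ x : Profile n, IsClusterProfile ε x := by
  refine ⟨fun i => if (i : ℕ) < 1 then 0 else if (i : ℕ) < 2 then 1 else
    if (i : ℕ) < n / 2 + 1 then ε else 1 - ε, ?_, ?_, ?_, ?_⟩
  · have := ncard_fin_Ico (n := n) (a := 0) (b := 1) (by omega)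
    rw [show 1 = 1 - 0 by omega, ← this]
    congr 1; ext i; simp only [Set.mem_ofPred_eq]
    split_ifs <;> constructor <;> intro h <;> first | omega | linarith
  · have := ncard_fin_Ico (n := n) (a := 1) (b := 2) (by omega)
    rw [show 1 = 2 - 1 by omega, ← this]
    congr 1; ext i; simp only [Set.mem_ofPred_eq]
    split_ifs <;> constructor <;> intro h <;> first | omega | linarith
  · have := ncard_fin_Ico (n := n) (a := 2) (b := n / 2 + 1) (by omega)
    rw [show n / 2 - 1 = n / 2 + 1 - 2 by omega, ← this]
    congr 1; ext i; simp only [Set.mem_ofPred_eq]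
    split_ifs <;> constructor <;> intro h <;> first | omega | linarith
  · have := ncard_fin_Ico (n := n) (a := n / 2 + 1) (b := n) le_rfl
    rw [show n - n / 2 - 1 = n - (n / 2 + 1) by omega, ← this]
    congr 1; ext i; simp only [Set.mem_ofPred_eq]
    split_ifs <;> constructor <;> intro h <;> first | omega | linarith

theorem IsConsistent.half_le {f : PredMechanism n} (hn : 5 ≤ n) (hf : PredStrategyProof f)
    {ρ γ : ℝ} (hρ : IsRobust f ρ) (hγ : IsConsistent f γ) : ((n / 2 : ℕ) : ℝ) / 2 ≤ γ := by
  -- Any `ε` in the admissible range would do, since it cancels in the ratio.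
  obtain ⟨x, hx⟩ := exists_isClusterProfile hn (ε := 1 / 8) (by norm_num) (by norm_num)
  have h1 := hx.le_SC hn (by norm_num) (by norm_num) (hf x) (hρ x)
  have h2 := hγ x
  rw [hx.opt_eq hn (by norm_num) (by norm_num)] at h2
  linarith

end TwoFacility

theorem theorem2 :
    (∀ n : ℕ, 5 ≤ n → ∀ f : TwoFacility.PredMechanism n,
      TwoFacility.PredStrategyProof f → (∃ ρ : ℝ, TwoFacility.IsRobust f ρ) →
        (∀ γ : ℝ, TwoFacility.IsConsistent f γ →
          (Even n → (n : ℝ) / 4 ≤ γ) ∧ (Odd n → ((n : ℝ) - 1) / 4 ≤ γ)) ∧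
        (∀ (ε : ℝ) (x : TwoFacility.Profile n), 0 < ε → ε < 1 / 4 →
          TwoFacility.IsClusterProfile ε x →
            TwoFacility.OPT x = 2 * ε ∧
              ((n / 2 : ℕ) : ℝ) * ε ≤ TwoFacility.SC (f x) x)) ∧
    (∀ (f : (n : ℕ) → TwoFacility.PredMechanism n) (γ : ℕ → ℝ),
      (∀ᶠ n in Filter.atTop, TwoFacility.PredStrategyProof (f n) ∧
        (∃ ρ : ℝ, TwoFacility.IsRobust (f n) ρ) ∧ TwoFacility.IsConsistent (f n) (γ n)) →
      (fun n : ℕ => (n : ℝ)) =O[Filter.atTop] γ) := by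
  refine ⟨fun n hn f hf ⟨ρ, hρ⟩ => ⟨fun γ hγ => ?_, fun ε x hε hε4 hx =>
    ⟨hx.opt_eq hn hε hε4, hx.le_SC hn hε hε4 (hf x) (hρ x)⟩⟩, fun f γ h => ?_⟩
  · have h := hγ.half_le hn hf hρ
    constructor
    · rintro ⟨k, rfl⟩
      rw [show (k + k) / 2 = k by omega] at h
      push_cast
      linarith
    · rintro ⟨k, rfl⟩
      rw [show (2 * k + 1) / 2 = k by omega] at h
      push_cast
      linarith
  -- From `n ≤ 4 * γ n + 1` and `n ≥ 5` follows `γ n ≥ 1`, so the summand `1` is absorbed into a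
  -- fifth multiple of `γ n`.
  · refine Asymptotics.IsBigO.of_bound 5 ?_
    filter_upwards [h, Filter.eventually_ge_atTop 5] with n ⟨hf, ⟨ρ, hρ⟩, hγ⟩ hn
    have h1 := hγ.half_le hn hf hρ
    have h2 : (n : ℝ) ≤ 2 * ((n / 2 : ℕ) : ℝ) + 1 := by
      exact_mod_cast (show n ≤ 2 * (n / 2) + 1 by omega)
    have h3 : (5 : ℝ) ≤ n := by exact_mod_cast hn
    rw [Real.norm_of_nonneg n.cast_nonneg]
    linarith [Real.le_norm_self (γ n)]
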